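/- Let $\mu$ and $\mu_n$ ($n\in\mathbb N$) be finite signed Borel measures on $\mathbb R$. Write $|\nu|=\nu^++\nu^-$ for the total variation measure of a finite signed measure $\nu$ with Jordan decomposition $\nu=\nu^+-\nu^-$, and $F^{(\nu)}(x)=\nu((-\infty,x])$, $x\in\mathbb R$, for its distribution function. Let $\lambda$ denote Lebesgue measure. Then $\mu_n\to\mu$ vaguely, that is, $$\lim_{n\to\infty}\int_{\mathbb R} f\,d\mu_n=\int_{\mathbb R} f\,d\mu\quad\text{for every continuous } f:\mathbb R\to\mathbb R \text{ with compact support},$$ if and only if both of the following hold: 1. $(\mu_n)$ is locally uniformly bounded in variation, that is, $\sup_{n\in\mathbb N}|\mu_n|([-r,r])<\infty$ for every $r\in\mathbb R$; 2. there is a sequence $(c_n)_{n\in\mathbb N}$ of real numbers such that $F^{(\mu_n)}+c_n$ converges to $F^{(\mu)}$ locally in Lebesgue measure, that is, for all $\varepsilon>0$ and $r>0$, $$\lim_{n\to\infty}\lambda\bigl(\{x\in[-r,r]:|F^{(\mu_n)}(x)+c_n-F^{(\mu)}(x)|>\varepsilon\}\bigr)=0.$$ -/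

import Mathlib

open MeasureTheory Filter Topology
open scoped CompactlySupported

namespace SignedConvergence

/-- The distribution function `F^(μ)(x) = μ((-∞, x])` of a finite signed Borel measure on `ℝ`. -/
noncomputable def distFun (μ : SignedMeasure ℝ) (x : ℝ) : ℝ := μ (Set.Iic x)

/-- Vague convergence: `∫ f dμ_n → ∫ f dμ` for every continuous compactly supported real `f`. -/
def VagueTendsto (μs : ℕ → SignedMeasure ℝ) (μ : SignedMeasure ℝ) : Prop :=
  ∀ f : C_c(ℝ, ℝ), Tendsto (fun n => ∫ᵛ x, f x ∂<•(μs n)) atTop (𝓝 (∫ᵛ x, f x ∂<•μ))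

/-- `sup_n |μ_n|([-r, r]) < ∞` for every real `r`. -/
def LocallyUniformlyBoundedInVariation (μs : ℕ → SignedMeasure ℝ) : Prop :=
  ∀ r : ℝ, (⨆ n, (μs n).totalVariation (Set.Icc (-r) r)) < ⊤

/-- Convergence in Lebesgue measure on every interval `[-r, r]`. -/
def TendstoLocallyInLebesgueMeasure (fs : ℕ → ℝ → ℝ) (f : ℝ → ℝ) : Prop :=
  ∀ r : ℝ, 0 < r → TendstoInMeasure (volume.restrict (Set.Icc (-r) r)) fs atTop f

end SignedConvergence

namespace SignedConvergence

/-! Everything is driven by Fubini (`integral_integral_swap_signed`): averaging indicators of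
half-lines or intervals turns the integral of a continuous function against `ν` into a Lebesgue
integral of values of `F^(ν)`. Put `ν_n = μ_n - μ`.

If `μ_n → μ` vaguely, Banach–Steinhaus applied to `f ↦ ∫ χ f dμ_n`, with `χ` a cutoff, bounds the
local variations. The difference of two ramps is a test function whose integral is a difference of
means of `F^(ν_n)`, so the means over `(x, x + k)`, minus the mean over `(0, 1)`, tend to `0` at
every `x`; the latter mean supplies `-c_n`. Moreover `F^(ν_n)(x)` differs from its `k`-mean by at
most `|ν_n|((x, x + k])`, whose integral over `[-r, r]` is `O(k)` uniformly in `n`, so Markov's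
inequality concludes.

Conversely, a test function `f` is uniformly close to its moving average, at a cost controlled by
the variation bound. The average integrates to `h⁻¹ ∫ f(s) ν_n((s - h, s]) ds`; the increments of
`F^(ν_n) + c_n` do not see `c_n`, and dominated convergence applies. -/

instance isFiniteMeasure_variation {X : Type*} [MeasurableSpace X] (ν : SignedMeasure X) :
    IsFiniteMeasure ν.variation := by
  rw [← SignedMeasure.totalVariation_eq_variation]; infer_instance

/-- Integration against a signed measure, in terms of its Jordan decomposition. -/
lemma integral_eq_posPart_sub_negPart {X : Type*} [MeasurableSpace X] (ν : SignedMeasure X)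
    {f : X → ℝ} (hf : Integrable f ν.variation) :
    ∫ᵛ x, f x ∂<•ν = ∫ x, f x ∂ν.toJordanDecomposition.posPart
      - ∫ x, f x ∂ν.toJordanDecomposition.negPart := by
  have hf' : Integrable f (ν.toJordanDecomposition.posPart + ν.toJordanDecomposition.negPart) := by
    rwa [← SignedMeasure.totalVariation_eq_variation] at hf
  obtain ⟨hp, hn⟩ := integrable_add_measure.1 hf'
  conv_lhs => rw [← ν.toSignedMeasure_toJordanDecomposition]
  rw [JordanDecomposition.toSignedMeasure, VectorMeasure.integral_sub_vectorMeasure,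
    VectorMeasure.integral_toSignedMeasure, VectorMeasure.integral_toSignedMeasure]
  · simpa [VectorMeasure.Integrable] using hp
  · simpa [VectorMeasure.Integrable] using hn

lemma abs_integral_le_integral_abs {X : Type*} [MeasurableSpace X] (ν : SignedMeasure X)
    (f : X → ℝ) : |∫ᵛ x, f x ∂<•ν| ≤ ∫ x, |f x| ∂ν.variation := by
  refine (VectorMeasure.norm_integral_le_integral_norm (μ := ν) (f := f)
    (B := (ContinuousLinearMap.lsmul ℝ ℝ).flip)).trans ?_
  rw [ContinuousLinearMap.opNorm_flip, ContinuousLinearMap.opNorm_lsmul, one_mul]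
  rfl

lemma integral_indicator_const {X : Type*} [MeasurableSpace X] (ν : SignedMeasure X)
    {s : Set X} (hs : MeasurableSet s) (c : ℝ) :
    ∫ᵛ x, s.indicator (fun _ => c) x ∂<•ν = c * ν s := by
  have := isFiniteMeasure_variation (ν.restrict s)
  rw [VectorMeasure.integral_indicator hs, VectorMeasure.integral_const]
  simp [VectorMeasure.restrict_apply, hs, mul_comm]

/-- Fubini's theorem for a signed measure and a positive measure. -/
lemma integral_integral_swap_signed {X Y : Type*} [MeasurableSpace X] [MeasurableSpace Y]
    (ν : SignedMeasure X) (m : Measure Y) [SFinite m] {K : X → Y → ℝ}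
    (hK : Integrable (Function.uncurry K) (ν.variation.prod m)) :
    ∫ᵛ x, (∫ y, K x y ∂m) ∂<•ν = ∫ y, (∫ᵛ x, K x y ∂<•ν) ∂m := by
  have hle := (SignedMeasure.totalVariation_eq_variation ν).le
  have hV : Integrable (fun x => ∫ y, K x y ∂m) ν.variation := hK.integral_prod_left
  have hp : Integrable (Function.uncurry K) (ν.toJordanDecomposition.posPart.prod m) :=
    hK.mono_measure (Measure.prod_mono (Measure.le_add_right le_rfl |>.trans hle) le_rfl)
  have hn : Integrable (Function.uncurry K) (ν.toJordanDecomposition.negPart.prod m) :=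
    hK.mono_measure (Measure.prod_mono (Measure.le_add_left le_rfl |>.trans hle) le_rfl)
  rw [integral_eq_posPart_sub_negPart ν hV, integral_integral_swap hp, integral_integral_swap hn]
  refine (integral_sub hp.integral_prod_right hn.integral_prod_right).symm.trans ?_
  refine integral_congr_ae ?_
  filter_upwards [hK.prod_left_ae] with y hy
  exact (integral_eq_posPart_sub_negPart ν hy).symm

lemma integrable_of_bounded {X : Type*} [MeasurableSpace X] {m : Measure X} [IsFiniteMeasure m]
    {f : X → ℝ} (hf : Measurable f) {C : ℝ} (hC : ∀ x, |f x| ≤ C) : Integrable f m :=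
  Integrable.of_bound hf.aestronglyMeasurable C (Eventually.of_forall hC)

/-! ### Distribution functions and variation bounds -/

lemma distFun_sub (μ ν : SignedMeasure ℝ) (x : ℝ) :
    distFun (μ - ν) x = distFun μ x - distFun ν x := rfl

lemma apply_Ioc (ν : SignedMeasure ℝ) {x y : ℝ} (h : x ≤ y) :
    ν (Set.Ioc x y) = distFun ν y - distFun ν x := by
  have := VectorMeasure.of_union (v := ν) (Set.Iic_disjoint_Ioc le_rfl)
    measurableSet_Iic (measurableSet_Ioc (a := x) (b := y))
  rw [Set.Iic_union_Ioc_eq_Iic h] at this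
  simp [distFun, this]

lemma apply_Ioi (ν : SignedMeasure ℝ) (x : ℝ) :
    ν (Set.Ioi x) = ν Set.univ - distFun ν x := by
  have := VectorMeasure.of_union (v := ν) (Set.Iic_disjoint_Ioi (le_refl x))
    measurableSet_Iic measurableSet_Ioi
  rw [Set.Iic_union_Ioi] at this
  simp [distFun, this]

lemma measurable_distFun (ν : SignedMeasure ℝ) : Measurable (distFun ν) := by
  have h : distFun ν = fun x => ν.toJordanDecomposition.posPart.real (Set.Iic x)
      - ν.toJordanDecomposition.negPart.real (Set.Iic x) := by
    funext x
    exact ν.apply_eq_posPart_real_sub_negPart_real measurableSet_Iic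
  rw [h]
  refine Measurable.sub ?_ ?_ <;>
  · refine Monotone.measurable fun x y hxy => ?_
    exact measureReal_mono (Set.Iic_subset_Iic.2 hxy)

lemma abs_apply_le (ν : SignedMeasure ℝ) (s : Set ℝ) : |ν s| ≤ ν.variation.real s := by
  rw [← SignedMeasure.totalVariation_eq_variation]
  exact ν.norm_le_totalVariation s

lemma abs_distFun_le (ν : SignedMeasure ℝ) (x : ℝ) : |distFun ν x| ≤ ν.variation.real Set.univ :=
  (abs_apply_le ν _).trans (measureReal_mono (Set.subset_univ _))

lemma LocallyUniformlyBoundedInVariation.exists_bound {μs : ℕ → SignedMeasure ℝ}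
    (h : LocallyUniformlyBoundedInVariation μs) (μ : SignedMeasure ℝ) (r : ℝ) :
    ∃ C : ℝ, 0 ≤ C ∧ ∀ n, (μs n - μ).variation (Set.Icc (-r) r) ≤ ENNReal.ofReal C := by
  have hfin : (⨆ n, (μs n).totalVariation (Set.Icc (-r) r)) + μ.variation (Set.Icc (-r) r) ≠ ⊤ :=
    ENNReal.add_ne_top.2 ⟨(h r).ne, measure_ne_top _ _⟩
  refine ⟨((⨆ n, (μs n).totalVariation (Set.Icc (-r) r)) +
    μ.variation (Set.Icc (-r) r)).toReal, ENNReal.toReal_nonneg, fun n => ?_⟩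
  rw [ENNReal.ofReal_toReal hfin]
  refine (VectorMeasure.variation_sub_le _).trans ?_
  rw [Measure.add_apply, ← SignedMeasure.totalVariation_eq_variation (μs n)]
  gcongr
  exact le_iSup (fun n => (μs n).totalVariation (Set.Icc (-r) r)) n

lemma integrable_compactlySupported (ν : SignedMeasure ℝ) (f : C_c(ℝ, ℝ)) :
    Integrable f ν.variation :=
  f.continuous.integrable_of_hasCompactSupport f.hasCompactSupport

lemma vagueTendsto_iff_sub {μs : ℕ → SignedMeasure ℝ} {μ : SignedMeasure ℝ} :
    VagueTendsto μs μ ↔ ∀ f : C_c(ℝ, ℝ),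
      Tendsto (fun n => ∫ᵛ x, f x ∂<•(μs n - μ)) atTop (𝓝 0) := by
  refine forall_congr' fun f => ?_
  rw [← tendsto_sub_nhds_zero_iff]
  refine tendsto_congr fun n => ?_
  rw [VectorMeasure.integral_sub_vectorMeasure (integrable_compactlySupported _ f)
    (integrable_compactlySupported _ f)]

/-! ### Local boundedness from the uniform boundedness principle -/

open scoped BoundedContinuousFunction

/-- The product of a compactly supported continuous function and a bounded continuous one. -/
def cutoffMul (χ : C_c(ℝ, ℝ)) (f : ℝ →ᵇ ℝ) : C_c(ℝ, ℝ) where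
  toFun x := χ x * f x
  continuous_toFun := χ.continuous.mul f.continuous
  hasCompactSupport' := χ.hasCompactSupport.mul_right

lemma integrable_cutoffMul (ν : SignedMeasure ℝ) (χ : C_c(ℝ, ℝ)) (f : ℝ →ᵇ ℝ) :
    Integrable (fun x => χ x * f x) ν.variation :=
  integrable_compactlySupported ν (cutoffMul χ f)

/-- The functional `f ↦ ∫ χ f dν` on bounded continuous functions. -/
noncomputable def cutoffIntegral (χ : C_c(ℝ, ℝ)) (ν : SignedMeasure ℝ) : (ℝ →ᵇ ℝ) →L[ℝ] ℝ :=
  LinearMap.mkContinuous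
    { toFun := fun f => ∫ᵛ x, χ x * f x ∂<•ν
      map_add' := fun f g => by
        rw [← VectorMeasure.integral_fun_add
          (integrable_cutoffMul ν χ f) (integrable_cutoffMul ν χ g)]
        simp [mul_add]
      map_smul' := fun c f => by
        rw [← VectorMeasure.integral_fun_smul]
        simp [mul_left_comm] }
    (∫ x, |χ x| ∂ν.variation)
    (fun f => by
      refine (abs_integral_le_integral_abs ν _).trans ?_
      rw [← integral_mul_const]
      refine integral_mono (integrable_cutoffMul ν χ f).abs
        ((integrable_compactlySupported ν χ).abs.mul_const _) fun x => ?_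
      simp only [abs_mul]
      exact mul_le_mul_of_nonneg_left (f.norm_coe_le_norm x) (abs_nonneg _))

lemma cutoffIntegral_apply (χ : C_c(ℝ, ℝ)) (ν : SignedMeasure ℝ) (f : ℝ →ᵇ ℝ) :
    cutoffIntegral χ ν f = ∫ᵛ x, χ x * f x ∂<•ν := rfl

/-- A continuous cutoff function which is `1` on `[-r, r]`. -/
noncomputable def cutoff (r : ℝ) : C_c(ℝ, ℝ) where
  toFun x := max 0 (min 1 (r + 1 - |x|))
  continuous_toFun := by fun_prop
  hasCompactSupport' := by
    refine HasCompactSupport.intro (isCompact_Icc (a := -(r + 1)) (b := r + 1)) fun x hx => ?_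
    have : r + 1 < |x| := by
      by_contra! h
      exact hx (abs_le.1 h)
    exact max_eq_left ((min_le_right _ _).trans (by linarith))

lemma cutoff_nonneg (r x : ℝ) : 0 ≤ cutoff r x := le_max_left _ _

lemma cutoff_le_one (r x : ℝ) : cutoff r x ≤ 1 := max_le zero_le_one (min_le_left _ _)

lemma cutoff_eq_one {r x : ℝ} (hx : x ∈ Set.Icc (-r) r) : cutoff r x = 1 := by
  have : |x| ≤ r := abs_le.2 hx
  change max 0 (min 1 (r + 1 - |x|)) = 1
  rw [min_eq_left (by linarith), max_eq_right zero_le_one]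

/-- The measure of a subset of `[-r, r]` is bounded by the norm of the cut-off integral. -/
lemma abs_apply_le_norm_cutoffIntegral (ν : SignedMeasure ℝ) {r : ℝ} {t : Set ℝ}
    (ht : MeasurableSet t) (htr : t ⊆ Set.Icc (-r) r) :
    |ν t| ≤ ‖cutoffIntegral (cutoff r) ν‖ := by
  refine le_of_forall_pos_le_add fun ε hε => ?_
  have hi : Integrable (t.indicator fun _ => (1 : ℝ)) ν.variation :=
    (integrable_const _).indicator ht
  obtain ⟨g, -, hgε, hgc, hgi⟩ := hi.exists_hasCompactSupport_integral_sub_le hε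
  -- Clipping to `[0, 1]` gives norm at most `1`. Neither clipping nor the cutoff increases the
  -- distance to the indicator: the cutoff is `1` on `t`, and off `t` both only shrink `|g|`.
  let g' : ℝ →ᵇ ℝ := BoundedContinuousFunction.ofNormedAddCommGroup
    (fun x => max 0 (min 1 (g x))) (by fun_prop) 1 fun x => by
      rw [Real.norm_eq_abs, abs_of_nonneg (le_max_left _ _)]
      exact max_le zero_le_one (min_le_left _ _)
  have hg'n : ‖g'‖ ≤ 1 := BoundedContinuousFunction.norm_ofNormedAddCommGroup_le _ zero_le_one _
  have hint := integrable_cutoffMul ν (cutoff r) g'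
  have hdiff : |ν t - cutoffIntegral (cutoff r) ν g'| ≤ ε := by
    have h1 : ν t = ∫ᵛ x, t.indicator (fun _ => (1 : ℝ)) x ∂<•ν := by
      rw [integral_indicator_const ν ht, one_mul]
    rw [h1, cutoffIntegral_apply, ← VectorMeasure.integral_fun_sub hi hint]
    refine (abs_integral_le_integral_abs ν _).trans (le_trans ?_ hgε)
    refine integral_mono (hi.sub hint).abs (hi.sub hgi).norm fun x => ?_
    change |t.indicator (fun _ => (1 : ℝ)) x - cutoff r x * max 0 (min 1 (g x))|
      ≤ |t.indicator (fun _ => (1 : ℝ)) x - g x|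
    by_cases hx : x ∈ t
    · rw [cutoff_eq_one (htr hx), Set.indicator_of_mem hx, one_mul]
      grind
    · rw [Set.indicator_of_notMem hx, zero_sub, zero_sub, abs_neg, abs_neg, abs_mul,
        abs_of_nonneg (cutoff_nonneg r x)]
      refine (mul_le_of_le_one_left (abs_nonneg _) (cutoff_le_one r x)).trans ?_
      grind
  have hb : |cutoffIntegral (cutoff r) ν g'| ≤ ‖cutoffIntegral (cutoff r) ν‖ :=
    ((cutoffIntegral (cutoff r) ν).le_opNorm g').trans
      (mul_le_of_le_one_right (norm_nonneg _) hg'n)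
  grind

/-- By the uniform boundedness principle, a vaguely convergent sequence is locally uniformly
bounded in variation. -/
lemma VagueTendsto.locallyUniformlyBoundedInVariation {μs : ℕ → SignedMeasure ℝ}
    {μ : SignedMeasure ℝ} (h : VagueTendsto μs μ) : LocallyUniformlyBoundedInVariation μs := by
  intro r
  obtain ⟨C, hC⟩ := banach_steinhaus (g := fun n => cutoffIntegral (cutoff r) (μs n)) fun f => by
    obtain ⟨C, hC⟩ := (h (cutoffMul (cutoff r) f)).norm.bddAbove_range
    exact ⟨C, fun n => hC ⟨n, rfl⟩⟩
  -- The factor `2` arises because one of the two Jordan parts carries at least half of the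
  -- variation.
  refine lt_of_le_of_lt (iSup_le fun n => ?_) (ENNReal.ofReal_lt_top (r := 2 * C))
  by_contra! hlt
  rw [SignedMeasure.totalVariation_eq_variation] at hlt
  obtain ⟨t, hts, htm, ht⟩ :=
    (μs n).exists_subset_lt_enorm_apply_of_lt_variation measurableSet_Icc hlt
  have hb := (abs_apply_le_norm_cutoffIntegral (μs n) htm hts).trans (hC n)
  refine ht.not_ge ?_
  rw [ENNReal.ofReal_mul zero_le_two, ENNReal.ofReal_ofNat, Real.enorm_eq_ofReal_abs]
  gcongr

/-! ### Ramps and means of distribution functions -/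

/-- The ramp function rising linearly from `0` at `x` to `1` at `x + h`. -/
noncomputable def ramp (x h t : ℝ) : ℝ := h⁻¹ * max 0 (min (x + h) t - x)

/-- The mean of `G` over the interval `(x, x + h)`. -/
noncomputable def mean (h : ℝ) (G : ℝ → ℝ) (x : ℝ) : ℝ := h⁻¹ * ∫ s in Set.Ioo x (x + h), G s

lemma ramp_eq_zero {x h t : ℝ} (ht : t ≤ x) : ramp x h t = 0 := by
  have : min (x + h) t - x ≤ 0 := by linarith [min_le_right (x + h) t]
  rw [ramp, max_eq_left this, mul_zero]

lemma ramp_eq_one {x h t : ℝ} (hh : 0 < h) (ht : x + h ≤ t) : ramp x h t = 1 := by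
  rw [ramp, min_eq_left ht, add_sub_cancel_left, max_eq_right hh.le, inv_mul_cancel₀ hh.ne']

/-- The difference of two ramps, as a compactly supported function. -/
noncomputable def rampSub (x : ℝ) {h : ℝ} (hh : 0 < h) (y : ℝ) {k : ℝ} (hk : 0 < k) :
    C_c(ℝ, ℝ) where
  toFun t := ramp x h t - ramp y k t
  continuous_toFun := by unfold ramp; fun_prop
  hasCompactSupport' := by
    refine HasCompactSupport.intro
      (isCompact_Icc (a := min x y) (b := max (x + h) (y + k))) fun t ht => ?_
    rcases lt_or_ge t (min x y) with h1 | h1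
    · rw [ramp_eq_zero (lt_min_iff.1 h1).1.le, ramp_eq_zero (lt_min_iff.1 h1).2.le, sub_zero]
    · have h2 : max (x + h) (y + k) < t := by
        by_contra! h2
        exact ht ⟨h1, h2⟩
      rw [ramp_eq_one hh (max_lt_iff.1 h2).1.le, ramp_eq_one hk (max_lt_iff.1 h2).2.le, sub_self]

lemma integrable_ramp (ν : SignedMeasure ℝ) (x : ℝ) {h : ℝ} (hh : 0 < h) :
    Integrable (ramp x h) ν.variation := by
  refine integrable_of_bounded (C := 1) (by unfold ramp; fun_prop) fun t => ?_
  have h1 : max 0 (min (x + h) t - x) ≤ h :=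
    max_le hh.le (by linarith [min_le_left (x + h) t])
  rw [ramp, abs_of_nonneg (by positivity), inv_mul_le_iff₀ hh, mul_one]
  exact h1

lemma integrableOn_distFun (ν : SignedMeasure ℝ) (x y : ℝ) :
    IntegrableOn (distFun ν) (Set.Ioo x y) :=
  integrable_of_bounded (measurable_distFun ν) (abs_distFun_le ν)

lemma integral_Ioo_const {x h : ℝ} (hh : 0 < h) (c : ℝ) :
    ∫ _ in Set.Ioo x (x + h), c = h * c := by
  rw [setIntegral_const, Real.volume_real_Ioo_of_le (by linarith), smul_eq_mul,
    add_sub_cancel_left]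

/-- The ramp is the average over `s ∈ (x, x + h)` of the indicators of `(s, ∞)`, and `ν((s, ∞)) =
ν(ℝ) - F^(ν)(s)`. -/
lemma integral_ramp (ν : SignedMeasure ℝ) (x : ℝ) {h : ℝ} (hh : 0 < h) :
    ∫ᵛ t, ramp x h t ∂<•ν = ν Set.univ - mean h (distFun ν) x := by
  have hS : MeasurableSet {p : ℝ × ℝ | p.2 < p.1} := measurableSet_lt measurable_snd measurable_fst
  have hramp : ∀ t, ramp x h t =
      h⁻¹ • ∫ s in Set.Ioo x (x + h), (Set.Ioi s).indicator (fun _ => (1 : ℝ)) t := by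
    intro t
    have : (fun s => (Set.Ioi s).indicator (fun _ => (1 : ℝ)) t)
        = (Set.Iio t).indicator fun _ => 1 := by
      funext s
      simp [Set.indicator_apply]
    rw [this, setIntegral_indicator measurableSet_Iio, Set.Ioo_inter_Iio, setIntegral_const,
      Measure.real, Real.volume_Ioo, ENNReal.toReal_ofReal', smul_eq_mul, smul_eq_mul, mul_one,
      max_comm, ramp]
  have hK : Integrable (Function.uncurry fun t s => (Set.Ioi s).indicator (fun _ => (1 : ℝ)) t)
      (ν.variation.prod (volume.restrict (Set.Ioo x (x + h)))) := by
    have : (Function.uncurry fun t s => (Set.Ioi s).indicator (fun _ => (1 : ℝ)) t)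
        = {p : ℝ × ℝ | p.2 < p.1}.indicator fun _ => 1 := by
      ext ⟨t, s⟩
      simp [Set.indicator_apply]
    rw [this]
    exact (integrable_const _).indicator hS
  simp_rw [hramp]
  rw [VectorMeasure.integral_fun_smul, integral_integral_swap_signed ν _ hK]
  simp_rw [integral_indicator_const ν measurableSet_Ioi, one_mul, apply_Ioi]
  rw [integral_sub (integrable_const _) (integrableOn_distFun ν _ _), integral_Ioo_const hh,
    smul_eq_mul, mean, mul_sub, inv_mul_cancel_left₀ hh.ne']

/-- The total mass, which vague convergence does not control, cancels in the difference. -/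
lemma integral_rampSub (ν : SignedMeasure ℝ) (x : ℝ) {h : ℝ} (hh : 0 < h) (y : ℝ) {k : ℝ}
    (hk : 0 < k) : ∫ᵛ t, rampSub x hh y hk t ∂<•ν =
      mean k (distFun ν) y - mean h (distFun ν) x := by
  have := VectorMeasure.integral_fun_sub (B := (ContinuousLinearMap.lsmul ℝ ℝ).flip)
    (integrable_ramp ν x hh) (integrable_ramp ν y hk)
  rw [integral_ramp ν x hh, integral_ramp ν y hk] at this
  refine Eq.trans this ?_
  ring

lemma continuous_mean (ν : SignedMeasure ℝ) {h : ℝ} (hh : 0 < h) :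
    Continuous (mean h (distFun ν)) := by
  have hi : ∀ a b, IntervalIntegrable (distFun ν) volume a b := fun a b => by
    rw [intervalIntegrable_iff, Set.uIoc]
    exact integrable_of_bounded (measurable_distFun ν) (abs_distFun_le ν)
  have hc := intervalIntegral.continuous_primitive hi 0
  have : mean h (distFun ν) = fun x =>
      h⁻¹ * ((∫ s in (0)..(x + h), distFun ν s) - ∫ s in (0)..x, distFun ν s) := by
    funext x
    rw [intervalIntegral.integral_interval_sub_left (hi _ _) (hi _ _),
      intervalIntegral.integral_of_le (by linarith), integral_Ioc_eq_integral_Ioo, mean]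
  rw [this]
  exact continuous_const.mul ((hc.comp (by fun_prop : Continuous fun x : ℝ => x + h)).sub hc)

/-! ### Distance of a distribution function from its means -/

/-- A distribution function differs from its mean by at most the local variation. -/
lemma abs_distFun_sub_mean_le (ν : SignedMeasure ℝ) (x : ℝ) {h : ℝ} (hh : 0 < h) :
    |distFun ν x - mean h (distFun ν) x| ≤ ν.variation.real (Set.Ioc x (x + h)) := by
  have h1 : distFun ν x - mean h (distFun ν) x =
      h⁻¹ * ∫ s in Set.Ioo x (x + h), (distFun ν x - distFun ν s) := by
    rw [integral_sub (integrable_const _) (integrableOn_distFun ν _ _), integral_Ioo_const hh,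
      mul_sub, inv_mul_cancel_left₀ hh.ne', mean]
  have h2 : ‖∫ s in Set.Ioo x (x + h), (distFun ν x - distFun ν s)‖ ≤
      ν.variation.real (Set.Ioc x (x + h)) * volume.real (Set.Ioo x (x + h)) := by
    refine norm_setIntegral_le_of_norm_le_const (by simp) fun s hs => ?_
    rw [Real.norm_eq_abs, abs_sub_comm, ← apply_Ioc ν hs.1.le]
    exact (abs_apply_le ν _).trans (measureReal_mono (Set.Ioc_subset_Ioc_right hs.2.le))
  rw [h1, abs_mul, abs_of_pos (inv_pos.2 hh), inv_mul_le_iff₀ hh, mul_comm h]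
  refine h2.trans_eq ?_
  rw [Real.volume_real_Ioo_of_le (by linarith), add_sub_cancel_left]

/-- Integrating the mass of a sliding window of length `h`. -/
lemma lintegral_measure_Ioc_le (V : Measure ℝ) [SFinite V] (r : ℝ) {h : ℝ} (hh : 0 < h) :
    ∫⁻ x in Set.Icc (-r) r, V (Set.Ioc x (x + h)) ≤
      ENNReal.ofReal h * V (Set.Icc (-(r + h)) (r + h)) := by
  let S : Set (ℝ × ℝ) := {p | p.1 < p.2 ∧ p.2 ≤ p.1 + h}
  have hS : MeasurableSet S := (measurableSet_lt measurable_fst measurable_snd).inter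
    (measurableSet_le measurable_snd (measurable_fst.add_const h))
  have e1 := Measure.prod_apply (μ := volume.restrict (Set.Icc (-r) r)) (ν := V) hS
  have e2 := Measure.prod_apply_symm (μ := volume.restrict (Set.Icc (-r) r)) (ν := V) hS
  have e3 : ∫⁻ x in Set.Icc (-r) r, V (Set.Ioc x (x + h)) =
      ∫⁻ t, volume.restrict (Set.Icc (-r) r) ((fun x => (x, t)) ⁻¹' S) ∂V := e1.symm.trans e2
  rw [e3, ← setLIntegral_const]
  rw [← lintegral_indicator measurableSet_Icc]
  refine lintegral_mono fun t => ?_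
  -- After the swap, a point `t` is seen only by windows starting in `[t - h, t)`, a set of length
  -- `h` that misses `[-r, r]` when `|t| > r + h`.
  have hsub : (fun x => (x, t)) ⁻¹' S ⊆ Set.Ico (t - h) t := fun x hx =>
    ⟨by linarith [hx.2], hx.1⟩
  by_cases ht : t ∈ Set.Icc (-(r + h)) (r + h)
  · rw [Set.indicator_of_mem ht]
    refine (Measure.restrict_apply_le _ _).trans ((measure_mono hsub).trans_eq ?_)
    rw [Real.volume_Ico, sub_sub_cancel]
  · rw [Set.indicator_of_notMem ht, nonpos_iff_eq_zero,
      Measure.restrict_apply (measurable_prodMk_right hS)]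
    refine measure_mono_null (fun x hx => ht ?_) measure_empty
    have h1 := hsub hx.1
    exact ⟨by linarith [hx.2.1, h1.2], by linarith [hx.2.2, h1.1]⟩

/-- Markov's inequality applied to the window masses. -/
lemma measure_le_abs_distFun_sub_mean_le (ν : SignedMeasure ℝ) (r : ℝ) {h ε : ℝ} (hh : 0 < h)
    (hε : 0 < ε) :
    volume.restrict (Set.Icc (-r) r) {x | ε ≤ |distFun ν x - mean h (distFun ν) x|} ≤
      ENNReal.ofReal h * ν.variation (Set.Icc (-(r + h)) (r + h)) / ENNReal.ofReal ε := by
  have hm : Measurable fun x => ENNReal.ofReal |distFun ν x - mean h (distFun ν) x| :=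
    (((measurable_distFun ν).sub (continuous_mean ν hh).measurable).abs).ennreal_ofReal
  have hsub : {x | ε ≤ |distFun ν x - mean h (distFun ν) x|} ⊆
      {x | ENNReal.ofReal ε ≤ ENNReal.ofReal |distFun ν x - mean h (distFun ν) x|} :=
    fun x hx => ENNReal.ofReal_le_ofReal hx
  refine (measure_mono hsub).trans ((meas_ge_le_lintegral_div hm.aemeasurable
    (by simpa using hε) ENNReal.ofReal_ne_top).trans ?_)
  gcongr
  refine le_trans (lintegral_mono fun x => ?_) (lintegral_measure_Ioc_le ν.variation r hh)
  exact ENNReal.ofReal_le_of_le_toReal (abs_distFun_sub_mean_le ν x hh)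

/-- Under vague convergence, the distribution functions, normalized by their mean over `(0, 1)`,
converge locally in Lebesgue measure. -/
lemma VagueTendsto.tendstoLocallyInLebesgueMeasure {μs : ℕ → SignedMeasure ℝ}
    {μ : SignedMeasure ℝ} (h : VagueTendsto μs μ) :
    TendstoLocallyInLebesgueMeasure
      (fun n x => distFun (μs n) x + -mean 1 (distFun (μs n - μ)) 0) (distFun μ) := by
  intro r hr
  obtain ⟨C, hC0, hC⟩ := h.locallyUniformlyBoundedInVariation.exists_bound μ (r + 1)
  rw [vagueTendsto_iff_sub] at h
  have hmean : ∀ k : ℝ, 0 < k → TendstoInMeasure (volume.restrict (Set.Icc (-r) r))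
      (fun n x => mean k (distFun (μs n - μ)) x - mean 1 (distFun (μs n - μ)) 0) atTop
      (fun _ => 0) := by
    intro k hk
    refine tendstoInMeasure_of_tendsto_ae
      (fun n => ((continuous_mean _ hk).sub continuous_const).aestronglyMeasurable)
      (Eventually.of_forall fun x => ?_)
    simpa only [integral_rampSub] using h (rampSub 0 one_pos x hk)
  rw [tendstoInMeasure_iff_norm]
  intro ε hε
  rw [ENNReal.tendsto_atTop_zero]
  intro δ hδ
  -- The window length is fixed before `n`, since `C` bounds all variations at once; `k ≤ 1` keeps
  -- the windows inside `[-(r + 1), r + 1]`.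
  obtain ⟨k, hk, hk1, hkδ⟩ : ∃ k : ℝ, 0 < k ∧ k ≤ 1 ∧
      ENNReal.ofReal k * ENNReal.ofReal C / ENNReal.ofReal (ε / 2) ≤ δ / 2 := by
    have hlim : Tendsto (fun k : ℝ => ENNReal.ofReal (k * C / (ε / 2))) (𝓝[>] 0) (𝓝 0) := by
      have : Tendsto (fun k : ℝ => ENNReal.ofReal (k * C / (ε / 2))) (𝓝 0) (𝓝 0) := by
        have hc : Continuous fun k : ℝ => ENNReal.ofReal (k * C / (ε / 2)) :=
          ENNReal.continuous_ofReal.comp (by fun_prop)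
        simpa using hc.tendsto 0
      exact this.mono_left nhdsWithin_le_nhds
    have hev := hlim.eventually_le_const (ENNReal.half_pos hδ.ne')
    have h1 : ∀ᶠ k : ℝ in 𝓝[>] 0, k ≤ 1 :=
      nhdsWithin_le_nhds (eventually_le_nhds one_pos)
    obtain ⟨k, ⟨hkδ, hk1⟩, hk⟩ := ((hev.and h1).and self_mem_nhdsWithin).exists
    refine ⟨k, hk, hk1, ?_⟩
    rwa [← ENNReal.ofReal_mul (le_of_lt hk), ← ENNReal.ofReal_div_of_pos (half_pos hε)]
  have hm := tendstoInMeasure_iff_norm.1 (hmean k hk) (ε / 2) (half_pos hε)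
  obtain ⟨N, hN⟩ := ENNReal.tendsto_atTop_zero.1 hm (δ / 2) (ENNReal.half_pos hδ.ne')
  refine ⟨N, fun n hn => ?_⟩
  have hsub : {x | ε ≤ ‖distFun (μs n) x + -mean 1 (distFun (μs n - μ)) 0 - distFun μ x‖} ⊆
      {x | ε / 2 ≤ ‖mean k (distFun (μs n - μ)) x - mean 1 (distFun (μs n - μ)) 0 - 0‖} ∪
      {x | ε / 2 ≤ |distFun (μs n - μ) x - mean k (distFun (μs n - μ)) x|} := by
    intro x hx
    by_contra hcon
    simp only [Set.mem_union, Set.mem_ofPred_eq, not_or, not_le, Real.norm_eq_abs] at hcon hx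
    rw [distFun_sub] at hcon
    grind
  refine (measure_mono hsub).trans ((measure_union_le _ _).trans ?_)
  rw [← ENNReal.add_halves δ]
  refine add_le_add (hN n hn) ?_
  refine (measure_le_abs_distFun_sub_mean_le (μs n - μ) r hk (half_pos hε)).trans (le_trans ?_ hkδ)
  gcongr
  exact (measure_mono (Set.Icc_subset_Icc (by linarith) (by linarith))).trans (hC n)

/-! ### Moving averages and the converse direction -/

/-- Integrating a moving average against a signed measure. -/
lemma integral_moving_average (ν : SignedMeasure ℝ) (f : C_c(ℝ, ℝ)) {h : ℝ} :
    ∫ᵛ t, (∫ s in Set.Ico t (t + h), f s) ∂<•ν = ∫ s, f s * ν (Set.Ioc (s - h) s) := by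
  have hS : MeasurableSet {p : ℝ × ℝ | p.2 - h < p.1 ∧ p.1 ≤ p.2} :=
    (measurableSet_lt (measurable_snd.sub_const h) measurable_fst).inter
      (measurableSet_le measurable_fst measurable_snd)
  have hf : Integrable (f : ℝ → ℝ) volume :=
    f.continuous.integrable_of_hasCompactSupport f.hasCompactSupport
  have hleft : ∀ t, ∫ s in Set.Ico t (t + h), f s =
      ∫ s, (Set.Ioc (s - h) s).indicator (fun _ => f s) t := by
    intro t
    rw [← MeasureTheory.integral_indicator measurableSet_Ico]
    refine integral_congr_ae (Eventually.of_forall fun s => ?_)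
    have : s ∈ Set.Ico t (t + h) ↔ t ∈ Set.Ioc (s - h) s := by
      simp only [Set.mem_Ico, Set.mem_Ioc, sub_lt_iff_lt_add]
      exact and_comm
    simp only [Set.indicator_apply, this]
  have hK : Integrable
      (Function.uncurry fun t s => (Set.Ioc (s - h) s).indicator (fun _ => f s) t)
      (ν.variation.prod volume) := by
    have : (Function.uncurry fun t s => (Set.Ioc (s - h) s).indicator (fun _ => f s) t)
        = {p : ℝ × ℝ | p.2 - h < p.1 ∧ p.1 ≤ p.2}.indicator fun p => f p.2 := by
      ext ⟨t, s⟩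
      simp [Set.indicator_apply]
    rw [this]
    exact (hf.comp_snd ν.variation).indicator hS
  simp_rw [hleft]
  rw [integral_integral_swap_signed ν _ hK]
  simp_rw [integral_indicator_const ν measurableSet_Ioc]

/-- The error of a moving average of a compactly supported function, against a signed measure. -/
lemma abs_integral_sub_moving_average_le (ν : SignedMeasure ℝ) (f : C_c(ℝ, ℝ)) {R h ε : ℝ}
    (hh : 0 < h) (hh1 : h ≤ 1) (hsupp : ∀ x, x ∉ Set.Icc (-R) R → f x = 0)
    (hf : ∀ x y, |x - y| ≤ h → |f x - f y| ≤ ε) :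
    |∫ᵛ t, f t ∂<•ν - h⁻¹ * ∫ s, f s * ν (Set.Ioc (s - h) s)| ≤
      ε * ν.variation.real (Set.Icc (-(R + 1)) (R + 1)) := by
  have hfi : ∀ a b, IntervalIntegrable (f : ℝ → ℝ) volume a b := fun a b =>
    f.continuous.intervalIntegrable a b
  have hdiff : ∀ t, |f t - h⁻¹ * ∫ s in Set.Ico t (t + h), f s| ≤
      (Set.Icc (-(R + 1)) (R + 1)).indicator (fun _ => ε) t := by
    intro t
    by_cases ht : t ∈ Set.Icc (-(R + 1)) (R + 1)
    · rw [Set.indicator_of_mem ht]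
      have hfI : IntegrableOn (fun s => f s) (Set.Ico t (t + h)) :=
        f.continuous.integrableOn_Icc.mono_set Set.Ico_subset_Icc_self
      have hI : ∫ s in Set.Ico t (t + h), (f t - f s) =
          h * f t - ∫ s in Set.Ico t (t + h), f s := by
        rw [integral_sub (integrable_const _) hfI, setIntegral_const,
          Real.volume_real_Ico_of_le (by linarith), smul_eq_mul, add_sub_cancel_left]
      have h2 : ‖∫ s in Set.Ico t (t + h), (f t - f s)‖ ≤ ε * volume.real (Set.Ico t (t + h)) := by
        refine norm_setIntegral_le_of_norm_le_const (by simp) fun s hs => hf t s ?_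
        rw [abs_sub_comm, abs_of_nonneg (by linarith [hs.1])]
        linarith [hs.2]
      rw [Real.volume_real_Ico_of_le (by linarith), add_sub_cancel_left, hI] at h2
      have h3 : f t - h⁻¹ * ∫ s in Set.Ico t (t + h), f s =
          h⁻¹ * (h * f t - ∫ s in Set.Ico t (t + h), f s) := by
        rw [mul_sub, inv_mul_cancel_left₀ hh.ne']
      rw [h3, abs_mul, abs_of_pos (inv_pos.2 hh), inv_mul_le_iff₀ hh, mul_comm h ε]
      exact h2
    · rw [Set.indicator_of_notMem ht, setIntegral_eq_zero_of_forall_eq_zero, hsupp t]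
      · simp
      · exact fun h' => ht ⟨by linarith [h'.1], by linarith [h'.2]⟩
      · intro s hs
        refine hsupp s fun h' => ht ⟨by linarith [h'.1, hs.2], by linarith [h'.2, hs.1]⟩
  have hmeas : Measurable fun t => h⁻¹ * ∫ s in Set.Ico t (t + h), f s := by
    have hc := intervalIntegral.continuous_primitive hfi 0
    have : (fun t => h⁻¹ * ∫ s in Set.Ico t (t + h), f s) = fun x =>
        h⁻¹ * ((∫ s in (0)..(x + h), f s) - ∫ s in (0)..x, f s) := by
      funext x
      rw [intervalIntegral.integral_interval_sub_left (hfi _ _) (hfi _ _),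
        intervalIntegral.integral_of_le (by linarith), integral_Ioc_eq_integral_Ioo,
        integral_Ico_eq_integral_Ioo]
    rw [this]
    exact (continuous_const.mul
      ((hc.comp (by fun_prop : Continuous fun x : ℝ => x + h)).sub hc)).measurable
  have hind : Integrable ((Set.Icc (-(R + 1)) (R + 1)).indicator fun _ => ε) ν.variation :=
    (integrable_const _).indicator measurableSet_Icc
  have hfν := integrable_compactlySupported ν f
  have hsub : Integrable (fun t => f t - h⁻¹ * ∫ s in Set.Ico t (t + h), f s) ν.variation :=
    hind.mono' (f.continuous.measurable.sub hmeas).aestronglyMeasurable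
      (Eventually.of_forall hdiff)
  have havg : Integrable (fun t => h⁻¹ * ∫ s in Set.Ico t (t + h), f s) ν.variation := by
    simpa [Pi.sub_def] using hfν.sub hsub
  rw [← integral_moving_average, ← smul_eq_mul, ← VectorMeasure.integral_fun_smul]
  simp_rw [smul_eq_mul]
  rw [← VectorMeasure.integral_fun_sub hfν havg]
  refine (abs_integral_le_integral_abs ν _).trans
    ((integral_mono hsub.abs hind hdiff).trans_eq ?_)
  rw [MeasureTheory.integral_indicator measurableSet_Icc, setIntegral_const, smul_eq_mul, mul_comm]

lemma tendsto_integral_mul_apply_Ioc {νs : ℕ → SignedMeasure ℝ} {c : ℕ → ℝ} (f : C_c(ℝ, ℝ))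
    {R h C : ℝ} (hR : 0 < R) (hh : 0 < h) (hh1 : h ≤ 1)
    (hsupp : ∀ x, x ∉ Set.Icc (-R) R → f x = 0)
    (hC : ∀ n, (νs n).variation.real (Set.Icc (-(R + 1)) (R + 1)) ≤ C)
    (hF : TendstoLocallyInLebesgueMeasure (fun n x => distFun (νs n) x + c n) fun _ => 0) :
    Tendsto (fun n => ∫ s, f s * νs n (Set.Ioc (s - h) s)) atTop (𝓝 0) := by
  -- Convergence in measure gives a.e. convergence only along subsequences, which suffices for a
  -- sequence of reals.
  refine tendsto_of_subseq_tendsto fun ns hns => ?_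
  obtain ⟨ms, -, hms⟩ := TendstoInMeasure.exists_seq_tendsto_ae
    (f := fun k x => distFun (νs (ns k)) x + c (ns k))
    fun ε hε => (hF (R + 1) (by linarith) ε hε).comp hns
  refine ⟨ms, ?_⟩
  rw [ae_restrict_iff' measurableSet_Icc] at hms
  -- Translation preserves null sets, so a.e. convergence also holds at `s - h`.
  have hms' := (measurePreserving_sub_right volume h).quasiMeasurePreserving.ae hms
  have hf : Integrable (f : ℝ → ℝ) volume :=
    f.continuous.integrable_of_hasCompactSupport f.hasCompactSupport
  have hlim := tendsto_integral_of_dominated_convergence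
    (F := fun k s => f s * νs (ns (ms k)) (Set.Ioc (s - h) s)) (f := fun _ => (0 : ℝ))
    (μ := volume) (fun s => |f s| * C) ?_ (hf.abs.mul_const C) ?_ ?_
  · simpa using hlim
  · intro k
    refine (f.continuous.measurable.mul ?_).aestronglyMeasurable
    simp_rw [fun s : ℝ => apply_Ioc (νs (ns (ms k))) (by linarith : s - h ≤ s)]
    exact (measurable_distFun _).sub
      ((measurable_distFun _).comp (measurable_id.sub_const h))
  · refine fun k => Eventually.of_forall fun s => ?_
    rw [norm_mul, Real.norm_eq_abs, Real.norm_eq_abs]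
    by_cases hs : s ∈ Set.Icc (-R) R
    · refine mul_le_mul_of_nonneg_left ((abs_apply_le _ _).trans
        ((measureReal_mono fun x hx => ?_).trans (hC _))) (abs_nonneg _)
      exact ⟨by linarith [hs.1, hx.1], by linarith [hs.2, hx.2]⟩
    · simp [hsupp s hs]
  · filter_upwards [hms, hms'] with s h1 h2
    by_cases hs : s ∈ Set.Icc (-R) R
    · have h3 := (h1 ⟨by linarith [hs.1], by linarith [hs.2]⟩).sub
        (h2 ⟨by linarith [hs.1], by linarith [hs.2]⟩)
      rw [sub_zero] at h3
      have h4 := h3.const_mul (f s)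
      rw [mul_zero] at h4
      refine h4.congr fun k => ?_
      rw [apply_Ioc _ (by linarith : s - h ≤ s)]
      ring
    · simp [hsupp s hs]

/-- The window `h` comes from uniform continuity of `f`, making the averaging error at most `ε / 2`
for all `n`; only then does `n → ∞`. -/
lemma vagueTendsto_of_tendstoLocallyInLebesgueMeasure {μs : ℕ → SignedMeasure ℝ}
    {μ : SignedMeasure ℝ} (hb : LocallyUniformlyBoundedInVariation μs) {c : ℕ → ℝ}
    (hF : TendstoLocallyInLebesgueMeasure (fun n x => distFun (μs n) x + c n) (distFun μ)) :
    VagueTendsto μs μ := by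
  rw [vagueTendsto_iff_sub]
  intro f
  have hF' : TendstoLocallyInLebesgueMeasure (fun n x => distFun (μs n - μ) x + c n)
      fun _ => 0 := by
    intro r hr
    have := hF r hr
    rw [tendstoInMeasure_iff_norm] at this ⊢
    simpa only [distFun_sub, sub_zero, sub_add_eq_add_sub] using this
  obtain ⟨R, hR, hsupp⟩ : ∃ R : ℝ, 0 < R ∧ ∀ x, x ∉ Set.Icc (-R) R → f x = 0 := by
    obtain ⟨R, hR0, hR⟩ := f.hasCompactSupport.isCompact.isBounded.exists_pos_norm_le
    refine ⟨R, hR0, fun x hx => ?_⟩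
    by_contra hfx
    exact hx (abs_le.1 (hR x (subset_tsupport _ hfx)))
  obtain ⟨C, hC0, hC⟩ := hb.exists_bound μ (R + 1)
  have hC' : ∀ n, (μs n - μ).variation.real (Set.Icc (-(R + 1)) (R + 1)) ≤ C :=
    fun n => ENNReal.toReal_le_of_le_ofReal hC0 (hC n)
  rw [Metric.tendsto_atTop]
  intro ε hε
  -- `C + 1` avoids dividing by zero when `C = 0`.
  obtain ⟨δ, hδ, hfδ⟩ := Metric.uniformContinuous_iff.1
    (f.hasCompactSupport.uniformContinuous_of_continuous f.continuous) (ε / (2 * (C + 1)))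
    (by positivity)
  let h := min 1 (δ / 2)
  have hh : 0 < h := lt_min one_pos (half_pos hδ)
  have hlim :=
    (tendsto_integral_mul_apply_Ioc f hR hh (min_le_left _ _) hsupp hC' hF').const_mul h⁻¹
  rw [mul_zero, Metric.tendsto_atTop] at hlim
  obtain ⟨N, hN⟩ := hlim (ε / 2) (half_pos hε)
  refine ⟨N, fun n hn => ?_⟩
  have h1 := hN n hn
  have h2 := abs_integral_sub_moving_average_le (μs n - μ) f (ε := ε / (2 * (C + 1))) hh
    (min_le_left _ _) hsupp fun x y hxy => (hfδ (lt_of_le_of_lt hxy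
      (lt_of_le_of_lt (min_le_right _ _) (half_lt_self hδ)))).le
  have h3 : ε / (2 * (C + 1)) * (μs n - μ).variation.real (Set.Icc (-(R + 1)) (R + 1)) ≤ ε / 2 := by
    refine (mul_le_mul_of_nonneg_left ((hC' n).trans (by linarith : C ≤ C + 1))
      (by positivity)).trans_eq ?_
    field_simp
  rw [Real.dist_0_eq_abs] at h1 ⊢
  have h4 := abs_sub_abs_le_abs_sub (∫ᵛ t, f t ∂<•(μs n - μ))
    (h⁻¹ * ∫ s, f s * (μs n - μ) (Set.Ioc (s - h) s))
  linarith

end SignedConvergence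

theorem corollary3p14 (μs : ℕ → MeasureTheory.SignedMeasure ℝ)
    (μ : MeasureTheory.SignedMeasure ℝ) :
    SignedConvergence.VagueTendsto μs μ ↔
      SignedConvergence.LocallyUniformlyBoundedInVariation μs ∧
        ∃ c : ℕ → ℝ, SignedConvergence.TendstoLocallyInLebesgueMeasure
          (fun n x => SignedConvergence.distFun (μs n) x + c n)
          (SignedConvergence.distFun μ) :=
  ⟨fun h => ⟨h.locallyUniformlyBoundedInVariation, _, h.tendstoLocallyInLebesgueMeasure⟩,
    fun ⟨hb, _, hF⟩ =>
      SignedConvergence.vagueTendsto_of_tendstoLocallyInLebesgueMeasure hb hF⟩
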